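/- Let $\rho$ be a state (density matrix) on $\mathbb{C}^{a}\otimes\mathbb{C}^{b}$. For a unit vector $\psi\in\mathbb{C}^{a}\otimes\mathbb{C}^{b}$ with reduced state $\rho_B=\mathrm{Tr}_A|\psi\rangle\langle\psi|$, let $$E_\alpha(\psi)=\frac{1}{1-\alpha}\log\mathrm{Tr}\,\rho_B^{\alpha}\quad(\alpha>0,\ \alpha\neq1),\qquad E_1(\psi)=-\mathrm{Tr}\,\rho_B\log\rho_B ,$$ $$E_{(\alpha,s)}(\psi)=\frac{1}{s(1-\alpha)}\left[e^{s(1-\alpha)E_\alpha(\psi)}-1\right]\quad(\alpha\neq 1,\ s\neq 0),$$ and for a function $f$ of pure states let $\mathrm{co}f(\rho)=\min\sum_\mu q_\mu f(\psi_\mu)$ be its convex roof, the minimum (infimum) being over all finite pure-state decompositions $\rho=\sum_\mu q_\mu|\psi_\mu\rangle\langle\psi_\mu|$ with $q_\mu\ge 0$. Suppose that $\rho$ is transformed by stochastic local operations and classical communication (SLOCC): in each of finitely many rounds one party performs a local measurement with finitely many Kraus operators $K_i$, $\sum_i K_i^\dagger K_i=1$ (the dimension of that party's system may change), and communicates the result,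 on which the later rounds may depend; at the end one of finitely many outcomes $M$, a coarse-graining of the sequence of all measurement results, is reported. All outcome states live on a common space $\mathbb{C}^{a'}\otimes\mathbb{C}^{b'}$. Let $p_M$ be the probability of outcome $M$ and $\rho_M$ the resulting state, and write $\langle g\rangle=\sum_M p_M\,g(\rho_M)$ and $P(g\ge t)=\sum_{M:\,g(\rho_M)\ge t}p_M$. Then: 1. For all $0<\alpha<1$, $\gamma\ge\alpha$ and $0<s\le 1/\alpha$, $$\mathrm{co}E_{(\alpha,s)}(\rho)\ \ge\ \frac{1}{s(1-\alpha)}\left[\left\langle e^{s(1-\alpha)\,\mathrm{co}E_\gamma}\right\rangle-1\right],$$ and, as the limiting case $s=0$, $\mathrm{co}E_\alpha(\rho)\ge\langle \mathrm{co}E_\gamma\rangle$. 2. For all $\alpha>0$ and $E_{\rm target}>0$, and for every $\beta$ with $0<\beta\le\alpha$ and $\beta<1$, $$P\left(\mathrm{co}E_\alpha\ge E_{\rm target}\right)\ \le\ \frac{\left(\frac{1-\beta}{\beta}\right)\mathrm{co}E_{(\beta,1/\beta)}(\rho)}{e^{\left(\frac{1-\beta}{\beta}\right)E_{\rm target}}-1},$$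 and $P(\mathrm{co}E_\alpha\ge E_{\rm target})$ is also at most the $\liminf$ of the right-hand side as $\beta\to0^+$. In particular, for $0<\alpha<1$ it is at most the minimum (infimum) of the right-hand side over $0\le\beta\le\alpha$, the value at $\beta=0$ being understood as the limit $\beta\to 0^+$. -/

import Mathlib

open scoped Matrix Kronecker ComplexOrder

noncomputable section

namespace Ent

/-- Operators on the bipartite space `ℂ^a ⊗ ℂ^b`. -/
abbrev Op (a b : ℕ) : Type := Matrix (Fin a × Fin b) (Fin a × Fin b) ℂ

/-- Vectors of the bipartite space `ℂ^a ⊗ ℂ^b`. -/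
abbrev Vec (a b : ℕ) : Type := Fin a × Fin b → ℂ

/-- A (mixed) state: positive semidefinite of trace one. -/
def IsState {a b : ℕ} (ρ : Op a b) : Prop :=
  ρ.PosSemidef ∧ ρ.trace = 1

/-- A pure state vector: `⟨ψ|ψ⟩ = 1`. -/
def IsUnitVec {a b : ℕ} (ψ : Vec a b) : Prop :=
  ∑ x, ‖ψ x‖ ^ 2 = 1

/-- The operator `|ψ⟩⟨ψ|`. -/
def ketbra {a b : ℕ} (ψ : Vec a b) : Op a b :=
  Matrix.vecMulVec ψ (star ψ)

/-- The partial trace over the first factor. -/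
def partialTraceA {a b : ℕ} (ρ : Op a b) : Matrix (Fin b) (Fin b) ℂ :=
  Matrix.of fun j j' => ∑ i, ρ (i, j) (i, j')

/-- The reduced state `ρ_B = Tr_A |ψ⟩⟨ψ|`. -/
def reducedB {a b : ℕ} (ψ : Vec a b) : Matrix (Fin b) (Fin b) ℂ :=
  partialTraceA (ketbra ψ)

theorem reducedB_isHermitian {a b : ℕ} (ψ : Vec a b) : (reducedB ψ).IsHermitian := by
  ext j j'
  simp [reducedB, partialTraceA, ketbra, Matrix.vecMulVec_apply, mul_comm]

/-- The Rényi entropy `(1 - α)⁻¹ log Tr σ^α` of order `α > 0` of a positive semidefinite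
matrix, computed from its eigenvalues; for `α = 1` it is the von Neumann entropy `-Tr σ log σ`. -/
def renyiEntropy (α : ℝ) {n : ℕ} {σ : Matrix (Fin n) (Fin n) ℂ} (hσ : σ.IsHermitian) : ℝ :=
  if α = 1 then ∑ i, Real.negMulLog (hσ.eigenvalues i)
  else 1 / (1 - α) * Real.log (∑ i, hσ.eigenvalues i ^ α)

/-- The Rényi entanglement entropy `E_α(ψ) = S_α(ρ_B)` of a pure state. -/
def REE (α : ℝ) {a b : ℕ} (ψ : Vec a b) : ℝ :=
  renyiEntropy α (reducedB_isHermitian ψ)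

/-- The generalised entanglement entropy `E_{(α,s)}(ψ)` of a pure state
(`α ≠ 1`, `s ≠ 0`). -/
def GEE (α s : ℝ) {a b : ℕ} (ψ : Vec a b) : ℝ :=
  1 / (s * (1 - α)) * (Real.exp (s * (1 - α) * REE α ψ) - 1)

/-- The convex roof of a function `f` of pure states: the least value of `∑ μ, q_μ f(ψ_μ)` over
the finite pure-state decompositions `ρ = ∑ μ, q_μ |ψ_μ⟩⟨ψ_μ|`. The weights of a decomposition of
a state sum to one automatically, by taking traces. -/
def convexRoof {a b : ℕ} (f : Vec a b → ℝ) (ρ : Op a b) : ℝ :=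
  sInf {v : ℝ | ∃ (n : ℕ) (q : Fin n → ℝ) (ψ : Fin n → Vec a b),
    (∀ μ, 0 ≤ q μ) ∧ (∀ μ, IsUnitVec (ψ μ)) ∧
    ρ = ∑ μ, (q μ : ℂ) • ketbra (ψ μ) ∧ v = ∑ μ, q μ * f (ψ μ)}

/-- `coE_α(ρ)`. -/
def coREE (α : ℝ) {a b : ℕ} (ρ : Op a b) : ℝ :=
  convexRoof (REE α) ρ

/-- `coE_{(α,s)}(ρ)`. -/
def coGEE (α s : ℝ) {a b : ℕ} (ρ : Op a b) : ℝ :=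
  convexRoof (GEE α s) ρ

/-- Stochastic LOCC protocols (with finitely many rounds) from `ℂ^a ⊗ ℂ^b` to `ℂ^a' ⊗ ℂ^b'`,
reporting one of the outcomes `0, …, m - 1`. In each round one of the two parties performs a
measurement with finitely many Kraus operators `K i`, `∑ i, (K i)ᴴ * K i = 1`, the result `i` is
communicated, and the continuation may depend on it; the dimension of the measured party may
change. A finished protocol reports a label. Different branches may report the same label, so that
a reported outcome is a coarse-graining of the fine-grained outcomes (the branches), each
of which is given by a single product Kraus operator. -/
inductive SLOCC (a' b' m : ℕ) : ℕ → ℕ → Type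
  | done (M : Fin m) : SLOCC a' b' m a' b'
  | alice {a b : ℕ} (n : ℕ) (c : Fin n → ℕ) (K : (i : Fin n) → Matrix (Fin (c i)) (Fin a) ℂ)
      (hK : ∑ i, (K i)ᴴ * K i = 1) (next : (i : Fin n) → SLOCC a' b' m (c i) b) :
      SLOCC a' b' m a b
  | bob {a b : ℕ} (n : ℕ) (c : Fin n → ℕ) (K : (i : Fin n) → Matrix (Fin (c i)) (Fin b) ℂ)
      (hK : ∑ i, (K i)ᴴ * K i = 1) (next : (i : Fin n) → SLOCC a' b' m a (c i)) :
      SLOCC a' b' m a b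

/-- The completely positive map `ρ ↦ p_M ρ_M` that belongs to the reported outcome `M`. -/
def SLOCC.map {a' b' m : ℕ} : {a b : ℕ} → SLOCC a' b' m a b → Fin m → Op a b → Op a' b'
  | _, _, .done M₀, M, ρ => if M = M₀ then ρ else 0
  | _, b, .alice _ _ K _ next, M, ρ =>
      ∑ i, (next i).map M
        ((K i ⊗ₖ (1 : Matrix (Fin b) (Fin b) ℂ)) * ρ * (K i ⊗ₖ (1 : Matrix (Fin b) (Fin b) ℂ))ᴴ)
  | a, _, .bob _ _ K _ next, M, ρ =>
      ∑ i, (next i).map M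
        (((1 : Matrix (Fin a) (Fin a) ℂ) ⊗ₖ K i) * ρ * ((1 : Matrix (Fin a) (Fin a) ℂ) ⊗ₖ K i)ᴴ)

/-- The probability `p_M` of the outcome `M`. -/
def SLOCC.prob {a' b' m a b : ℕ} (Λ : SLOCC a' b' m a b) (ρ : Op a b) (M : Fin m) : ℝ :=
  (Λ.map M ρ).trace.re

/-- The state `ρ_M` after the outcome `M` (only meaningful if `p_M ≠ 0`). -/
def SLOCC.post {a' b' m a b : ℕ} (Λ : SLOCC a' b' m a b) (ρ : Op a b) (M : Fin m) : Op a' b' :=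
  ((Λ.prob ρ M)⁻¹ : ℂ) • Λ.map M ρ

/-- The average `⟨g⟩ = ∑ M, p_M g(ρ_M)` over the outcomes. -/
def SLOCC.average {a' b' m a b : ℕ} (Λ : SLOCC a' b' m a b) (ρ : Op a b) (g : Op a' b' → ℝ) : ℝ :=
  ∑ M, Λ.prob ρ M * g (Λ.post ρ M)

/-- The accumulated success probability `P(g ≥ t)`, the sum of `p_M` over the outcomes with
`g(ρ_M) ≥ t`. -/
def SLOCC.successProb {a' b' m a b : ℕ} (Λ : SLOCC a' b' m a b) (ρ : Op a b)
    (g : Op a' b' → ℝ) (t : ℝ) : ℝ :=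
  ∑ M, if t ≤ g (Λ.post ρ M) then Λ.prob ρ M else 0

/-- The bound `((1-β)/β) coE_{(β,1/β)}(ρ) / (e^{((1-β)/β) t} - 1)`, for `0 < β < 1`. -/
def distillBound {a b : ℕ} (ρ : Op a b) (t β : ℝ) : ℝ :=
  (1 - β) / β * coGEE β (1 / β) ρ / (Real.exp ((1 - β) / β * t) - 1)

end Ent

end

/-! The quantity that carries the proof is F(σ) = (Tr σ^α)^(1/α), 0 < α ≤ 1. On positive
semidefinite matrices it is superadditive and homogeneous (`sum_mul_rootPowerTrace_le`), by
concavity of x ↦ x^α and the reverse Minkowski inequality. Write a pure vector as a matrix Y, so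
that ρ_B = Y Yᴴ. A measurement by Alice splits Y Yᴴ into the unnormalised reduced states of the
branches; one by Bob splits Yᴴ Y, which has the same nonzero spectrum. Hence the sum of F over all
branches of a protocol is at most its initial value (`SLOCC.exists_branches`). For a unit vector and
α < 1, F = exp(((1-α)/α) E_α), so this is the pure-state case s = 1/α; Jensen for the power t^(sα)
gives smaller s, and Jensen for the logarithm gives s = 0.

For a mixed state, each vector of a decomposition is sent through the protocol. The branches
labelled M, renormalised, decompose ρ_M into pure states, so the convex roof of ρ_M is at most their
average. The bound E_γ ≤ E_α brings in γ, and convexity of the increasing function G absorbs the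
coarse-graining (`SLOCC.average_le`). The probability bound is Markov's inequality for e^(cE) - 1
with c = (1-β)/β. -/

namespace Ent

/-! ### Jensen, reverse Minkowski, and Rényi entropies of probability vectors. -/

section RealInequalities

variable {ι κ : Type*} [Fintype ι] [Fintype κ]

/-- Jensen's inequality for the logarithm. -/
theorem sum_mul_log_le_log_sum {w z : ι → ℝ} (hw : ∀ i, 0 ≤ w i) (hw1 : ∑ i, w i = 1)
    (hz : ∀ i, w i ≠ 0 → 0 < z i) :
    ∑ i, w i * Real.log (z i) ≤ Real.log (∑ i, w i * z i) := by
  have hnn : ∀ i, 0 ≤ w i * z i := fun i => by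
    rcases eq_or_ne (w i) 0 with h | h
    · simp [h]
    · exact mul_nonneg (hw i) (hz i h).le
  have hS : 0 < ∑ i, w i * z i := by
    obtain ⟨i, -, hi⟩ : ∃ i ∈ Finset.univ, w i ≠ 0 := by
      apply Finset.exists_ne_zero_of_sum_ne_zero
      rw [hw1]; exact one_ne_zero
    exact Finset.sum_pos' (fun i _ => hnn i)
      ⟨i, Finset.mem_univ _, mul_pos (lt_of_le_of_ne (hw i) hi.symm) (hz i hi)⟩
  set S := ∑ i, w i * z i with hSdef
  -- Tangent line of the logarithm at the mean: log (z/S) ≤ z/S - 1, and the corrections sum to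
  -- zero.
  have key : ∑ i, w i * Real.log (z i) ≤ ∑ i, (w i * Real.log S + (w i * z i / S - w i)) := by
    refine Finset.sum_le_sum fun i _ => ?_
    rcases eq_or_ne (w i) 0 with h | h
    · simp [h]
    · have hzi := hz i h
      have h1 := Real.log_le_sub_one_of_pos (div_pos hzi hS)
      rw [Real.log_div hzi.ne' hS.ne'] at h1
      have h2 := mul_le_mul_of_nonneg_left h1 (hw i)
      have h3 : w i * z i / S = w i * (z i / S) := by ring
      rw [h3]; linarith
  refine key.trans (le_of_eq ?_)
  rw [Finset.sum_add_distrib, Finset.sum_sub_distrib, ← Finset.sum_mul, ← Finset.sum_div,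
    ← hSdef, hw1, div_self hS.ne']
  ring

/-- Jensen's inequality for the concave power functions. -/
theorem sum_mul_rpow_le_rpow_sum {w z : ι → ℝ} (hw : ∀ i, 0 ≤ w i) (hw1 : ∑ i, w i = 1)
    (hz : ∀ i, 0 ≤ z i) {θ : ℝ} (h0 : 0 < θ) (h1 : θ ≤ 1) :
    ∑ i, w i * z i ^ θ ≤ (∑ i, w i * z i) ^ θ := by
  have h := Real.arith_mean_le_rpow_mean Finset.univ w (fun i => z i ^ θ) (fun i _ => hw i) hw1
    (fun i _ => Real.rpow_nonneg (hz i) _) (p := 1 / θ) (by rw [le_div_iff₀ h0]; linarith)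
  have h2 : ∀ i, (z i ^ θ) ^ (1 / θ) = z i := fun i => by
    rw [← Real.rpow_mul (hz i), mul_one_div_cancel h0.ne', Real.rpow_one]
  simpa only [h2, one_div_one_div] using h

/-- The reverse Minkowski inequality for exponents in `(0, 1)`. -/
theorem sum_rpow_sum_le {α : ℝ} (h0 : 0 < α) (h1 : α ≤ 1) {x : ι → κ → ℝ}
    (hx : ∀ i k, 0 ≤ x i k) :
    ∑ i, (∑ k, x i k ^ α) ^ (1 / α) ≤ (∑ k, (∑ i, x i k) ^ α) ^ (1 / α) := by
  have hp : 1 ≤ 1 / α := by rw [le_div_iff₀ h0]; linarith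
  have hp0 : 0 < 1 / α := by positivity
  have : Fact (1 ≤ ENNReal.ofReal (1 / α)) := ⟨by simpa using hp⟩
  have hpr : (ENNReal.ofReal (1 / α)).toReal = 1 / α := ENNReal.toReal_ofReal hp0.le
  -- The claim is the triangle inequality in ℓ^(1/α) for the vectors (x i k ^ α)_i, raised to the
  -- power 1/α.
  let v : κ → PiLp (ENNReal.ofReal (1 / α)) (fun _ : ι => ℝ) :=
    fun k => WithLp.toLp _ (fun i => x i k ^ α)
  have h := norm_sum_le Finset.univ v
  have hv : ∀ k, ‖v k‖ = (∑ i, x i k) ^ α := fun k => by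
    rw [PiLp.norm_eq_sum (by rw [hpr]; exact hp0), hpr, one_div_one_div]
    congr 1
    refine Finset.sum_congr rfl fun i _ => ?_
    simp only [v]
    rw [Real.norm_of_nonneg (Real.rpow_nonneg (hx i k) _), ← Real.rpow_mul (hx i k),
      mul_one_div_cancel h0.ne', Real.rpow_one]
  have hsum : ‖∑ k, v k‖ = (∑ i, (∑ k, x i k ^ α) ^ (1 / α)) ^ α := by
    rw [PiLp.norm_eq_sum (by rw [hpr]; exact hp0), hpr, one_div_one_div]
    congr 1
    refine Finset.sum_congr rfl fun i _ => ?_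
    rw [Real.norm_of_nonneg]
    · simp [v]
    · simp only [WithLp.ofLp_sum, Finset.sum_apply, v]
      exact Finset.sum_nonneg fun k _ => Real.rpow_nonneg (hx i k) _
  rw [hsum] at h
  simp only [hv] at h
  have hnn : 0 ≤ ∑ i, (∑ k, x i k ^ α) ^ (1 / α) :=
    Finset.sum_nonneg fun i _ => Real.rpow_nonneg
      (Finset.sum_nonneg fun k _ => Real.rpow_nonneg (hx i k) _) _
  have h3 := Real.rpow_le_rpow (Real.rpow_nonneg hnn _) h hp0.le
  rwa [← Real.rpow_mul hnn, mul_one_div_cancel h0.ne', Real.rpow_one] at h3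

/-- The Rényi entropy of order `α` of a probability vector, Shannon's entropy for `α = 1`. -/
noncomputable def renyi (α : ℝ) (x : ι → ℝ) : ℝ :=
  if α = 1 then ∑ i, Real.negMulLog (x i) else 1 / (1 - α) * Real.log (∑ i, x i ^ α)

theorem sum_rpow_pos {x : ι → ℝ} (hx : ∀ i, 0 ≤ x i) (hx1 : ∑ i, x i = 1) (α : ℝ) :
    0 < ∑ i, x i ^ α := by
  obtain ⟨i, -, hi⟩ : ∃ i ∈ Finset.univ, x i ≠ 0 := by
    apply Finset.exists_ne_zero_of_sum_ne_zero
    rw [hx1]; exact one_ne_zero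
  exact Finset.sum_pos' (fun i _ => Real.rpow_nonneg (hx i) _)
    ⟨i, Finset.mem_univ _, Real.rpow_pos_of_pos (lt_of_le_of_ne (hx i) hi.symm) _⟩

theorem le_one_of_sum_eq_one {x : ι → ℝ} (hx : ∀ i, 0 ≤ x i) (hx1 : ∑ i, x i = 1) (i : ι) :
    x i ≤ 1 :=
  hx1 ▸ Finset.single_le_sum (fun i _ => hx i) (Finset.mem_univ i)

theorem mul_rpow_sub_one {x α : ℝ} (hx : 0 ≤ x) (h : α ≠ 0) : x * x ^ (α - 1) = x ^ α := by
  rcases hx.eq_or_lt with rfl | hx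
  · simp [Real.zero_rpow h]
  · rw [Real.rpow_sub_one hx.ne', mul_div_cancel₀ _ hx.ne']

theorem renyi_nonneg {x : ι → ℝ} (hx : ∀ i, 0 ≤ x i) (hx1 : ∑ i, x i = 1) {α : ℝ} (hα : 0 < α) :
    0 ≤ renyi α x := by
  have hle := le_one_of_sum_eq_one hx hx1
  unfold renyi
  split_ifs with h
  · exact Finset.sum_nonneg fun i _ => Real.negMulLog_nonneg (hx i) (hle i)
  · rcases lt_or_gt_of_ne h with h | h
    · refine mul_nonneg (by have := sub_pos.2 h; positivity) (Real.log_nonneg ?_)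
      rw [← hx1]
      exact Finset.sum_le_sum fun i _ => by
        simpa using Real.rpow_le_rpow_of_exponent_ge_of_imp (hx i) (hle i) h.le
          (fun _ h => by linarith)
    · refine mul_nonneg_of_nonpos_of_nonpos (one_div_nonpos.2 (by linarith))
        (Real.log_nonpos (sum_rpow_pos hx hx1 α).le ?_)
      rw [← hx1]
      exact Finset.sum_le_sum fun i _ => by
        simpa using Real.rpow_le_rpow_of_exponent_ge_of_imp (hx i) (hle i) h.le
          (fun _ h => by linarith)

/-- Jensen for the logarithm with weights x and values x^(α-1). The sign of 1 - α decides, on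
division, on which side of Shannon's entropy the order-α entropy lies. -/
theorem sub_one_mul_sum_le_log {x : ι → ℝ} (hx : ∀ i, 0 ≤ x i) (hx1 : ∑ i, x i = 1) {α : ℝ}
    (hα : 0 < α) : (1 - α) * ∑ i, Real.negMulLog (x i) ≤ Real.log (∑ i, x i ^ α) := by
  have h := sum_mul_log_le_log_sum (z := fun i => x i ^ (α - 1)) hx hx1
    (fun i hi => Real.rpow_pos_of_pos (lt_of_le_of_ne (hx i) hi.symm) _)
  simp only [mul_rpow_sub_one (hx _) hα.ne'] at h
  refine le_trans (le_of_eq ?_) h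
  rw [Finset.mul_sum]
  refine Finset.sum_congr rfl fun i _ => ?_
  rcases (hx i).eq_or_lt with h0 | h0
  · simp [← h0]
  · rw [Real.log_rpow h0, Real.negMulLog]; ring

/-- The Rényi entropies decrease with the order. -/
theorem renyi_anti {x : ι → ℝ} (hx : ∀ i, 0 ≤ x i) (hx1 : ∑ i, x i = 1) {α γ : ℝ}
    (hα : 0 < α) (hα1 : α < 1) (hγ : α ≤ γ) : renyi γ x ≤ renyi α x := by
  have hα' : 0 < 1 - α := by linarith
  have h1 : ∑ i, Real.negMulLog (x i) ≤ renyi α x := by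
    rw [renyi, if_neg hα1.ne, one_div, ← div_eq_inv_mul, le_div_iff₀ hα', mul_comm]
    exact sub_one_mul_sum_le_log hx hx1 hα
  rcases lt_trichotomy γ 1 with h | h | h
  · have hγ' : 0 < 1 - γ := by linarith
    -- The exponent turns x^(α-1) into x^(γ-1); it is at most 1 because α ≤ γ.
    have hJ := sum_mul_rpow_le_rpow_sum hx hx1 (z := fun i => x i ^ (α - 1))
      (fun i => Real.rpow_nonneg (hx i) _) (θ := (1 - γ) / (1 - α)) (by positivity)
      ((div_le_one hα').2 (by linarith))
    have he : ∀ i, (x i ^ (α - 1)) ^ ((1 - γ) / (1 - α)) = x i ^ (γ - 1) := fun i => by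
      rw [← Real.rpow_mul (hx i)]; congr 1; field_simp; ring
    simp only [he, mul_rpow_sub_one (hx _) hα.ne',
      mul_rpow_sub_one (hx _) (hα.trans_le hγ).ne'] at hJ
    have hl := Real.log_le_log (sum_rpow_pos hx hx1 γ) hJ
    rw [Real.log_rpow (sum_rpow_pos hx hx1 α)] at hl
    rw [renyi, renyi, if_neg h.ne, if_neg hα1.ne, one_div, ← div_eq_inv_mul, div_le_iff₀ hγ']
    refine hl.trans (le_of_eq ?_)
    ring
  · rwa [renyi, if_pos h]
  · refine le_trans ?_ h1
    have hl := sub_one_mul_sum_le_log hx hx1 (hα.trans_le hγ)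
    rw [renyi, if_neg h.ne', one_div, ← div_eq_inv_mul, div_le_iff_of_neg (by linarith), mul_comm]
    exact hl

end RealInequalities

/-! ### Traces of powers of positive semidefinite matrices. -/

section PowerTrace

variable {n : Type*} [Fintype n] [DecidableEq n]

/-- The diagonal entries of a Hermitian matrix in an orthonormal basis are averages of its
eigenvalues. -/
theorem re_dotProduct_mulVec_eq_sum_eigenvalues {τ : Matrix n n ℂ} (hτ : τ.IsHermitian)
    (e : EuclideanSpace ℂ n) :
    (star (e : n → ℂ) ⬝ᵥ τ *ᵥ (e : n → ℂ)).re =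
      ∑ j, ‖inner ℂ (hτ.eigenvectorBasis j) e‖ ^ 2 * hτ.eigenvalues j := by
  have hc : ∀ j, ((hτ.eigenvectorUnitary : Matrix n n ℂ)ᴴ *ᵥ (e : n → ℂ)) j =
      inner ℂ (hτ.eigenvectorBasis j) e := fun j => by
    simp [Matrix.mulVec, dotProduct, PiLp.inner_apply, mul_comm]
  have hc' : ∀ j, (star (e : n → ℂ) ᵥ* (hτ.eigenvectorUnitary : Matrix n n ℂ)) j =
      star (inner ℂ (hτ.eigenvectorBasis j) e) := fun j => by
    have h := congrFun (Matrix.star_mulVec (hτ.eigenvectorUnitary : Matrix n n ℂ)ᴴ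
      (e : n → ℂ)) j
    rw [Matrix.conjTranspose_conjTranspose] at h
    rw [← h, ← hc]
    rfl
  conv_lhs => rw [hτ.spectral_theorem, Unitary.conjStarAlgAut_apply]
  rw [Matrix.star_eq_conjTranspose, ← Matrix.mulVec_mulVec, ← Matrix.mulVec_mulVec,
    Matrix.dotProduct_mulVec, dotProduct, Complex.re_sum]
  refine Finset.sum_congr rfl fun j _ => ?_
  rw [Matrix.mulVec_diagonal, hc, hc', ← Complex.normSq_eq_norm_sq]
  generalize inner ℂ (hτ.eigenvectorBasis j) e = z
  simp [Complex.normSq_apply]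
  ring

/-- The quantity `(Tr σ^α)^(1/α)` of a Hermitian matrix. -/
noncomputable def rootPowerTrace (α : ℝ) {σ : Matrix n n ℂ} (hσ : σ.IsHermitian) : ℝ :=
  (∑ i, hσ.eigenvalues i ^ α) ^ (1 / α)

/-- The trace of the powers does not decrease when the spectrum is averaged. -/
theorem sum_eigenvalues_rpow_le {τ : Matrix n n ℂ} (hτ : τ.PosSemidef)
    (e : OrthonormalBasis n ℂ (EuclideanSpace ℂ n)) {α : ℝ} (h0 : 0 < α) (h1 : α ≤ 1) :
    ∑ j, hτ.1.eigenvalues j ^ α ≤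
      ∑ k, (star (e k : n → ℂ) ⬝ᵥ τ *ᵥ (e k : n → ℂ)).re ^ α := by
  calc ∑ j, hτ.1.eigenvalues j ^ α
      = ∑ j, ∑ k, ‖inner ℂ (hτ.1.eigenvectorBasis j) (e k)‖ ^ 2 * hτ.1.eigenvalues j ^ α := by
        refine Finset.sum_congr rfl fun j _ => ?_
        rw [← Finset.sum_mul, e.sum_sq_norm_inner_left]
        simp
    _ = ∑ k, ∑ j, ‖inner ℂ (hτ.1.eigenvectorBasis j) (e k)‖ ^ 2 * hτ.1.eigenvalues j ^ α :=
        Finset.sum_comm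
    _ ≤ _ := by
        -- The squared overlaps of the two bases form a doubly stochastic matrix: one marginal
        -- inserted the double sum, the other supplies the weights for Jensen.
        refine Finset.sum_le_sum fun k _ => ?_
        rw [re_dotProduct_mulVec_eq_sum_eigenvalues hτ.1]
        refine sum_mul_rpow_le_rpow_sum (fun j => by positivity) ?_ hτ.eigenvalues_nonneg h0 h1
        rw [hτ.1.eigenvectorBasis.sum_sq_norm_inner_right]
        simp

/-- `(Tr σ^α)^(1/α)` is superadditive and homogeneous on positive semidefinite matrices. -/
theorem sum_mul_rootPowerTrace_le {ι : Type*} [Fintype ι] {σ : Matrix n n ℂ}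
    (hσ : σ.IsHermitian) {τ : ι → Matrix n n ℂ} (hτ : ∀ i, (τ i).PosSemidef) {p : ι → ℝ}
    (hp : ∀ i, 0 ≤ p i) (h : σ = ∑ i, (p i : ℂ) • τ i) {α : ℝ} (h0 : 0 < α) (h1 : α ≤ 1) :
    ∑ i, p i * rootPowerTrace α (hτ i).1 ≤ rootPowerTrace α hσ := by
  -- Diagonal entries in the eigenbasis of σ, where the eigenvalues of σ are exactly the weighted
  -- sums of those of the τ i.
  set d : ι → n → ℝ := fun i k => (star (hσ.eigenvectorBasis k : n → ℂ) ⬝ᵥ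
    τ i *ᵥ (hσ.eigenvectorBasis k : n → ℂ)).re with hd
  have hd0 : ∀ i k, 0 ≤ d i k := fun i k => (hτ i).re_dotProduct_nonneg _
  have hσd : ∀ k, hσ.eigenvalues k = ∑ i, p i * d i k := fun k => by
    have hv : ∀ v : n → ℂ, (star v ⬝ᵥ σ *ᵥ v).re = ∑ i, p i * (star v ⬝ᵥ τ i *ᵥ v).re :=
      fun v => by simp [h, Matrix.sum_mulVec, dotProduct_sum, Matrix.smul_mulVec]
    exact (hσ.eigenvalues_eq k).trans (hv _)
  unfold rootPowerTrace
  simp only [hσd]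
  refine le_trans ?_ (sum_rpow_sum_le h0 h1 (x := fun i k => p i * d i k)
    fun i k => mul_nonneg (hp i) (hd0 i k))
  refine Finset.sum_le_sum fun i _ => ?_
  have hs : ∑ k, (p i * d i k) ^ α = p i ^ α * ∑ k, d i k ^ α := by
    rw [Finset.mul_sum]
    exact Finset.sum_congr rfl fun k _ => Real.mul_rpow (hp i) (hd0 i k)
  rw [hs, Real.mul_rpow (Real.rpow_nonneg (hp i) _)
    (Finset.sum_nonneg fun k _ => Real.rpow_nonneg (hd0 i k) _), ← Real.rpow_mul (hp i),
    mul_one_div_cancel h0.ne', Real.rpow_one]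
  refine mul_le_mul_of_nonneg_left (Real.rpow_le_rpow (Finset.sum_nonneg fun k _ =>
    Real.rpow_nonneg ((hτ i).eigenvalues_nonneg k) _) ?_ (by positivity)) (hp i)
  exact sum_eigenvalues_rpow_le (hτ i) hσ.eigenvectorBasis h0 h1

/-- Roots of the characteristic polynomial allow spectra of matrices of different sizes to be
compared. -/
theorem sum_eigenvalues_eq_roots_sum {σ : Matrix n n ℂ} (hσ : σ.IsHermitian) (f : ℝ → ℝ) :
    ∑ i, f (hσ.eigenvalues i) = (σ.charpoly.roots.map fun z => f z.re).sum := by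
  rw [hσ.roots_charpoly_eq_eigenvalues, Multiset.map_map]
  simp [Function.comp_def]

/-- `Y Yᴴ` and `Yᴴ Y` have the same nonzero spectrum. -/
theorem rootPowerTrace_mul_comm {m : Type*} [Fintype m] [DecidableEq m] (Y : Matrix m n ℂ)
    (h₁ : (Y * Yᴴ).IsHermitian) (h₂ : (Yᴴ * Y).IsHermitian) {α : ℝ} (h0 : 0 < α) :
    rootPowerTrace α h₁ = rootPowerTrace α h₂ := by
  unfold rootPowerTrace
  congr 1
  rw [sum_eigenvalues_eq_roots_sum h₁ (fun x => x ^ α),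
    sum_eigenvalues_eq_roots_sum h₂ (fun x => x ^ α)]
  have h := congrArg Polynomial.roots (Matrix.charpoly_mul_comm' Y Yᴴ)
  -- The extra zero eigenvalues contribute 0^α = 0.
  have hX : ∀ (k : ℕ) (p : Polynomial ℂ), p.Monic →
      (((Polynomial.X ^ k * p).roots).map fun z : ℂ => z.re ^ α).sum =
        (p.roots.map fun z : ℂ => z.re ^ α).sum := fun k p hp => by
    rw [Polynomial.roots_mul ((Polynomial.monic_X_pow k).mul hp).ne_zero, Polynomial.roots_X_pow]
    simp [Multiset.nsmul_singleton, Real.zero_rpow h0.ne']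
  rw [← hX (Fintype.card n) _ (Matrix.charpoly_monic _), h, hX _ _ (Matrix.charpoly_monic _)]

/-- The spectral decomposition in terms of eigenvectors. -/
theorem eq_sum_eigenvalues_smul_vecMulVec {σ : Matrix n n ℂ} (hσ : σ.IsHermitian) :
    σ = ∑ k, (hσ.eigenvalues k : ℂ) •
      Matrix.vecMulVec (hσ.eigenvectorBasis k : n → ℂ) (star (hσ.eigenvectorBasis k : n → ℂ)) := by
  conv_lhs => rw [hσ.spectral_theorem, Unitary.conjStarAlgAut_apply]
  ext i j
  rw [Matrix.mul_apply, Matrix.sum_apply]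
  refine Finset.sum_congr rfl fun k _ => ?_
  simp [Matrix.mul_diagonal, Matrix.vecMulVec_apply]
  ring

end PowerTrace

/-! ### Pure states as coefficient matrices. -/

section PureStates

variable {a b c : ℕ}

/-- The coefficients of a vector of `ℂ^a ⊗ ℂ^b` as a `b × a` matrix. -/
def coeffMatrix (ψ : Vec a b) : Matrix (Fin b) (Fin a) ℂ :=
  Matrix.of fun j i => ψ (i, j)

theorem reducedB_eq (ψ : Vec a b) : reducedB ψ = coeffMatrix ψ * (coeffMatrix ψ)ᴴ := by
  ext j j'
  simp [reducedB, partialTraceA, ketbra, Matrix.vecMulVec_apply, coeffMatrix, Matrix.mul_apply]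

theorem reducedB_posSemidef (ψ : Vec a b) : (reducedB ψ).PosSemidef := by
  rw [reducedB_eq]
  exact Matrix.posSemidef_self_mul_conjTranspose _

theorem coeffMatrix_kronecker_one_mulVec (K : Matrix (Fin c) (Fin a) ℂ) (ψ : Vec a b) :
    coeffMatrix ((K ⊗ₖ (1 : Matrix (Fin b) (Fin b) ℂ)) *ᵥ ψ) = coeffMatrix ψ * Kᵀ := by
  ext j i
  simp [coeffMatrix, Matrix.mulVec, dotProduct, Matrix.mul_apply, Fintype.sum_prod_type,
    Matrix.one_apply, mul_comm]

theorem coeffMatrix_one_kronecker_mulVec (K : Matrix (Fin c) (Fin b) ℂ) (ψ : Vec a b) :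
    coeffMatrix (((1 : Matrix (Fin a) (Fin a) ℂ) ⊗ₖ K) *ᵥ ψ) = K * coeffMatrix ψ := by
  ext j i
  simp [coeffMatrix, Matrix.mulVec, dotProduct, Matrix.mul_apply, Fintype.sum_prod_type,
    Matrix.one_apply]

theorem mul_ketbra_mul_conjTranspose {a' b' : ℕ}
    (A : Matrix (Fin a' × Fin b') (Fin a × Fin b) ℂ) (ψ : Vec a b) :
    A * ketbra ψ * Aᴴ = ketbra (A *ᵥ ψ) := by
  rw [ketbra, ketbra, Matrix.mul_vecMulVec, Matrix.vecMulVec_mul, Matrix.star_mulVec]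

/-- The squared norm of a vector. -/
noncomputable def normSq (ψ : Vec a b) : ℝ := ∑ x, ‖ψ x‖ ^ 2

theorem trace_ketbra (ψ : Vec a b) : (ketbra ψ).trace = (normSq ψ : ℂ) := by
  simp [ketbra, Matrix.trace, Matrix.vecMulVec_apply, normSq, Complex.mul_conj']

theorem trace_reducedB (ψ : Vec a b) : (reducedB ψ).trace = (normSq ψ : ℂ) := by
  rw [← trace_ketbra]
  simp [reducedB, partialTraceA, Matrix.trace, Fintype.sum_prod_type_right]

/-- The quantity `(Tr ρ_B^α)^(1/α)` of a not necessarily normalised pure state. -/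
noncomputable def pureRoot (α : ℝ) (ψ : Vec a b) : ℝ :=
  rootPowerTrace α (reducedB_isHermitian ψ)

theorem rootPowerTrace_congr {n : Type*} [Fintype n] [DecidableEq n] {σ τ : Matrix n n ℂ}
    (h : σ = τ) (hσ : σ.IsHermitian) (hτ : τ.IsHermitian) (α : ℝ) :
    rootPowerTrace α hσ = rootPowerTrace α hτ := by
  subst h; rfl

theorem pureRoot_eq_conj (ψ : Vec a b) {α : ℝ} (h0 : 0 < α) :
    pureRoot α ψ = rootPowerTrace α
      (Matrix.posSemidef_conjTranspose_mul_self (coeffMatrix ψ)).1 := by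
  rw [← rootPowerTrace_mul_comm (coeffMatrix ψ)
    (Matrix.posSemidef_self_mul_conjTranspose _).1 _ h0]
  exact rootPowerTrace_congr (reducedB_eq ψ) _ _ α

/-! ### Effect of one local measurement on a pure state. -/

section Measurement

variable {n : ℕ} {d : Fin n → ℕ}

/-- No signalling: Alice's operator multiplies the coefficient matrix on the right by Kᵀ, so the
branches resum by completeness. -/
theorem reducedB_eq_sum_alice {K : (i : Fin n) → Matrix (Fin (d i)) (Fin a) ℂ}
    (hK : ∑ i, (K i)ᴴ * K i = 1) (ψ : Vec a b) :
    reducedB ψ = ∑ i, reducedB ((K i ⊗ₖ (1 : Matrix (Fin b) (Fin b) ℂ)) *ᵥ ψ) := by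
  have h : ∀ i, reducedB ((K i ⊗ₖ (1 : Matrix (Fin b) (Fin b) ℂ)) *ᵥ ψ) =
      coeffMatrix ψ * ((K i)ᴴ * K i)ᵀ * (coeffMatrix ψ)ᴴ := fun i => by
    rw [reducedB_eq, coeffMatrix_kronecker_one_mulVec, Matrix.conjTranspose_mul,
      Matrix.transpose_mul]
    simp only [Matrix.mul_assoc]
    rfl
  rw [Finset.sum_congr rfl fun i _ => h i, ← Matrix.sum_mul, ← Matrix.mul_sum,
    ← Matrix.transpose_sum, hK, Matrix.transpose_one, Matrix.mul_one, reducedB_eq]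

/-- Bob's operator acts on the left, so completeness applies only to Yᴴ Y, the counterpart of the
reduced state on Alice's side. -/
theorem conj_eq_sum_bob {K : (i : Fin n) → Matrix (Fin (d i)) (Fin b) ℂ}
    (hK : ∑ i, (K i)ᴴ * K i = 1) (ψ : Vec a b) :
    (coeffMatrix ψ)ᴴ * coeffMatrix ψ =
      ∑ i, (coeffMatrix (((1 : Matrix (Fin a) (Fin a) ℂ) ⊗ₖ K i) *ᵥ ψ))ᴴ *
        coeffMatrix (((1 : Matrix (Fin a) (Fin a) ℂ) ⊗ₖ K i) *ᵥ ψ) := by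
  have h : ∀ i, (coeffMatrix (((1 : Matrix (Fin a) (Fin a) ℂ) ⊗ₖ K i) *ᵥ ψ))ᴴ *
        coeffMatrix (((1 : Matrix (Fin a) (Fin a) ℂ) ⊗ₖ K i) *ᵥ ψ) =
      (coeffMatrix ψ)ᴴ * ((K i)ᴴ * K i) * coeffMatrix ψ := fun i => by
    rw [coeffMatrix_one_kronecker_mulVec, Matrix.conjTranspose_mul]
    simp only [Matrix.mul_assoc]
  rw [Finset.sum_congr rfl fun i _ => h i, ← Matrix.sum_mul, ← Matrix.mul_sum, hK, Matrix.mul_one]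

theorem sum_normSq_alice {K : (i : Fin n) → Matrix (Fin (d i)) (Fin a) ℂ}
    (hK : ∑ i, (K i)ᴴ * K i = 1) (ψ : Vec a b) :
    ∑ i, normSq ((K i ⊗ₖ (1 : Matrix (Fin b) (Fin b) ℂ)) *ᵥ ψ) = normSq ψ := by
  have h := congrArg Matrix.trace (reducedB_eq_sum_alice hK ψ)
  simp only [Matrix.trace_sum, trace_reducedB] at h
  exact_mod_cast h.symm

theorem sum_normSq_bob {K : (i : Fin n) → Matrix (Fin (d i)) (Fin b) ℂ}
    (hK : ∑ i, (K i)ᴴ * K i = 1) (ψ : Vec a b) :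
    ∑ i, normSq (((1 : Matrix (Fin a) (Fin a) ℂ) ⊗ₖ K i) *ᵥ ψ) = normSq ψ := by
  have h := congrArg Matrix.trace (conj_eq_sum_bob hK ψ)
  simp only [Matrix.trace_sum, Matrix.trace_mul_comm (coeffMatrix _)ᴴ, ← reducedB_eq,
    trace_reducedB] at h
  exact_mod_cast h.symm

theorem sum_pureRoot_alice_le {K : (i : Fin n) → Matrix (Fin (d i)) (Fin a) ℂ}
    (hK : ∑ i, (K i)ᴴ * K i = 1) (ψ : Vec a b) {α : ℝ} (h0 : 0 < α) (h1 : α ≤ 1) :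
    ∑ i, pureRoot α ((K i ⊗ₖ (1 : Matrix (Fin b) (Fin b) ℂ)) *ᵥ ψ) ≤ pureRoot α ψ := by
  have h := sum_mul_rootPowerTrace_le (reducedB_isHermitian ψ)
    (τ := fun i => reducedB ((K i ⊗ₖ (1 : Matrix (Fin b) (Fin b) ℂ)) *ᵥ ψ))
    (fun i => reducedB_posSemidef _) (p := fun _ => 1) (fun _ => zero_le_one)
    (by simpa using reducedB_eq_sum_alice hK ψ) h0 h1
  simpa [pureRoot] using h

theorem sum_pureRoot_bob_le {K : (i : Fin n) → Matrix (Fin (d i)) (Fin b) ℂ}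
    (hK : ∑ i, (K i)ᴴ * K i = 1) (ψ : Vec a b) {α : ℝ} (h0 : 0 < α) (h1 : α ≤ 1) :
    ∑ i, pureRoot α (((1 : Matrix (Fin a) (Fin a) ℂ) ⊗ₖ K i) *ᵥ ψ) ≤ pureRoot α ψ := by
  simp only [pureRoot_eq_conj _ h0]
  have h := sum_mul_rootPowerTrace_le
    (Matrix.posSemidef_conjTranspose_mul_self (coeffMatrix ψ)).1
    (fun i => Matrix.posSemidef_conjTranspose_mul_self
      (coeffMatrix (((1 : Matrix (Fin a) (Fin a) ℂ) ⊗ₖ K i) *ᵥ ψ)))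
    (p := fun _ => 1) (fun _ => zero_le_one)
    (by simpa using conj_eq_sum_bob hK ψ) h0 h1
  simpa using h

end Measurement

theorem ketbra_real_smul (r : ℝ) (ψ : Vec a b) :
    ketbra ((r : ℂ) • ψ) = ((r ^ 2 : ℝ) : ℂ) • ketbra ψ := by
  ext x y
  simp [ketbra, Matrix.vecMulVec_apply]
  ring

theorem partialTraceA_smul (c : ℂ) (ρ : Op a b) :
    partialTraceA (c • ρ) = c • partialTraceA ρ := by
  ext j j'
  simp [partialTraceA, Finset.mul_sum]

/-- Superadditivity with a single summand; this half of homogeneity suffices to normalise the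
branches. -/
theorem sq_mul_pureRoot_le (r : ℝ) (ψ : Vec a b) {α : ℝ} (h0 : 0 < α) (h1 : α ≤ 1) :
    r ^ 2 * pureRoot α ψ ≤ pureRoot α ((r : ℂ) • ψ) := by
  have h := sum_mul_rootPowerTrace_le (ι := Unit) (reducedB_isHermitian ((r : ℂ) • ψ))
    (τ := fun _ => reducedB ψ) (fun i => reducedB_posSemidef _) (p := fun _ => r ^ 2)
    (fun _ => sq_nonneg r)
    (by rw [reducedB, ketbra_real_smul, partialTraceA_smul]; simp [reducedB]) h0 h1
  simpa [pureRoot] using h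

/-- A vector is a multiple of a unit vector, as soon as there is any nonzero vector. -/
theorem exists_isUnitVec_smul {φ₀ : Vec a b} (h₀ : normSq φ₀ ≠ 0) (φ : Vec a b) :
    ∃ χ : Vec a b, IsUnitVec χ ∧ φ = ((√(normSq φ) : ℝ) : ℂ) • χ := by
  have hnn : ∀ ψ : Vec a b, 0 ≤ normSq ψ := fun ψ => Finset.sum_nonneg fun _ _ => by positivity
  have hunit : ∀ ψ : Vec a b, normSq ψ ≠ 0 →
      IsUnitVec (((√(normSq ψ))⁻¹ : ℂ) • ψ) := fun ψ hψ => by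
    simp only [IsUnitVec, Pi.smul_apply, smul_eq_mul, norm_mul, mul_pow, ← Finset.mul_sum]
    rw [norm_inv, Complex.norm_real, Real.norm_of_nonneg (Real.sqrt_nonneg _), inv_pow,
      Real.sq_sqrt (hnn ψ)]
    exact inv_mul_cancel₀ hψ
  by_cases h : normSq φ = 0
  -- A zero branch has weight zero, so any unit vector serves; φ₀ guarantees that one exists.
  · refine ⟨_, hunit φ₀ h₀, ?_⟩
    have hz : φ = 0 := by
      funext x
      have := (Finset.sum_eq_zero_iff_of_nonneg fun x _ => by positivity).1 h x
        (Finset.mem_univ x)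
      simpa using this
    rw [h]; simp [hz]
  · refine ⟨_, hunit φ h, ?_⟩
    rw [smul_smul, mul_inv_cancel₀, one_smul]
    have := (Real.sqrt_ne_zero (hnn φ)).2 h
    exact_mod_cast this

theorem sum_eigenvalues_reducedB {ψ : Vec a b} (hψ : IsUnitVec ψ) :
    ∑ i, (reducedB_isHermitian ψ).eigenvalues i = 1 := by
  have h := (reducedB_isHermitian ψ).trace_eq_sum_eigenvalues
  rw [trace_reducedB, show normSq ψ = 1 from hψ] at h
  have h' : ((∑ i, (reducedB_isHermitian ψ).eigenvalues i : ℝ) : ℂ) = ((1 : ℝ) : ℂ) := by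
    rw [h]; simp
  exact_mod_cast h'

theorem REE_nonneg {ψ : Vec a b} (hψ : IsUnitVec ψ) {α : ℝ} (hα : 0 < α) : 0 ≤ REE α ψ :=
  renyi_nonneg (reducedB_posSemidef ψ).eigenvalues_nonneg (sum_eigenvalues_reducedB hψ) hα

theorem REE_anti {ψ : Vec a b} (hψ : IsUnitVec ψ) {α γ : ℝ} (h0 : 0 < α) (h1 : α < 1)
    (h : α ≤ γ) : REE γ ψ ≤ REE α ψ :=
  renyi_anti (reducedB_posSemidef ψ).eigenvalues_nonneg (sum_eigenvalues_reducedB hψ) h0 h1 h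

theorem pureRoot_eq_exp {ψ : Vec a b} (hψ : IsUnitVec ψ) {α : ℝ} (h1 : α < 1) :
    pureRoot α ψ = Real.exp ((1 - α) / α * REE α ψ) := by
  have hpos := sum_rpow_pos (reducedB_posSemidef ψ).eigenvalues_nonneg
    (sum_eigenvalues_reducedB hψ) α
  have h1' : 1 - α ≠ 0 := by linarith
  rw [pureRoot, rootPowerTrace, REE, renyiEntropy, if_neg h1.ne, Real.rpow_def_of_pos hpos]
  congr 1
  field_simp

end PureStates

/-! ### Convex roofs and pure-state decompositions. -/

section ConvexRoof

variable {a b : ℕ}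

theorem sum_weights_eq_trace {ι : Type*} [Fintype ι] {q : ι → ℝ} {ψ : ι → Vec a b}
    (hψ : ∀ μ, IsUnitVec (ψ μ)) :
    (∑ μ, (q μ : ℂ) • ketbra (ψ μ)).trace = ((∑ μ, q μ : ℝ) : ℂ) := by
  have h1 : ∀ μ, normSq (ψ μ) = 1 := hψ
  simp [Matrix.trace_sum, Matrix.trace_smul, trace_ketbra, h1]

/-- Nonnegativity of f bounds the set below, without which the real `sInf` need not be a lower
bound. Arbitrary finite index types are allowed so that branches can serve as labels. -/
theorem convexRoof_le {f : Vec a b → ℝ} (hf : ∀ ψ, IsUnitVec ψ → 0 ≤ f ψ)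
    {ι : Type*} [Fintype ι] {q : ι → ℝ} {ψ : ι → Vec a b} (hq : ∀ μ, 0 ≤ q μ)
    (hψ : ∀ μ, IsUnitVec (ψ μ)) :
    convexRoof f (∑ μ, (q μ : ℂ) • ketbra (ψ μ)) ≤ ∑ μ, q μ * f (ψ μ) := by
  refine csInf_le ⟨0, ?_⟩ ?_
  · rintro v ⟨n, q, ψ, hq, hψ, -, rfl⟩
    exact Finset.sum_nonneg fun μ _ => mul_nonneg (hq μ) (hf _ (hψ μ))
  · let e := Fintype.equivFin ι
    refine ⟨Fintype.card ι, q ∘ e.symm, ψ ∘ e.symm, fun μ => hq _, fun μ => hψ _, ?_, ?_⟩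
    · exact (Equiv.sum_comp e.symm fun μ => (q μ : ℂ) • ketbra (ψ μ)).symm
    · exact (Equiv.sum_comp e.symm fun μ => q μ * f (ψ μ)).symm

theorem convexRoof_nonneg {f : Vec a b → ℝ} (hf : ∀ ψ, IsUnitVec ψ → 0 ≤ f ψ) (ρ : Op a b) :
    0 ≤ convexRoof f ρ := by
  refine Real.sInf_nonneg ?_
  rintro v ⟨n, q, ψ, hq, hψ, -, rfl⟩
  exact Finset.sum_nonneg fun μ _ => mul_nonneg (hq μ) (hf _ (hψ μ))

/-- Every state has a finite pure-state decomposition. -/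
theorem IsState.exists_decomposition {ρ : Op a b} (hρ : IsState ρ) :
    ∃ (n : ℕ) (q : Fin n → ℝ) (ψ : Fin n → Vec a b), (∀ μ, 0 ≤ q μ) ∧
      (∀ μ, IsUnitVec (ψ μ)) ∧ ρ = ∑ μ, (q μ : ℂ) • ketbra (ψ μ) := by
  let e := Fintype.equivFin (Fin a × Fin b)
  have hu : ∀ k, IsUnitVec (hρ.1.1.eigenvectorBasis k : Fin a × Fin b → ℂ) := fun k => by
    have h := EuclideanSpace.norm_sq_eq (hρ.1.1.eigenvectorBasis k)
    rw [OrthonormalBasis.norm_eq_one, one_pow] at h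
    exact h.symm
  refine ⟨Fintype.card (Fin a × Fin b), hρ.1.1.eigenvalues ∘ e.symm,
    fun k => hρ.1.1.eigenvectorBasis (e.symm k), fun k => hρ.1.eigenvalues_nonneg _,
    fun k => hu _, ?_⟩
  exact (eq_sum_eigenvalues_smul_vecMulVec hρ.1.1).trans (Equiv.sum_comp e.symm _).symm

theorem IsState.sum_weights_eq_one {ρ : Op a b} (hρ : IsState ρ) {ι : Type*} [Fintype ι]
    {q : ι → ℝ} {ψ : ι → Vec a b} (hψ : ∀ μ, IsUnitVec (ψ μ))
    (hd : ρ = ∑ μ, (q μ : ℂ) • ketbra (ψ μ)) : ∑ μ, q μ = 1 := by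
  have ht := hρ.2
  rw [hd, sum_weights_eq_trace hψ] at ht
  exact_mod_cast ht

/-- A lower bound for all decompositions of a state is a lower bound for the convex roof. -/
theorem le_convexRoof {f : Vec a b → ℝ} {ρ : Op a b} (hρ : IsState ρ) {v : ℝ}
    (h : ∀ (n : ℕ) (q : Fin n → ℝ) (ψ : Fin n → Vec a b), (∀ μ, 0 ≤ q μ) →
      (∀ μ, IsUnitVec (ψ μ)) → ρ = ∑ μ, (q μ : ℂ) • ketbra (ψ μ) → ∑ μ, q μ = 1 →
      v ≤ ∑ μ, q μ * f (ψ μ)) :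
    v ≤ convexRoof f ρ := by
  obtain ⟨n, q, ψ, hq, hψ, hd⟩ := hρ.exists_decomposition
  refine le_csInf ⟨_, n, q, ψ, hq, hψ, hd, rfl⟩ ?_
  rintro w ⟨n, q, ψ, hq, hψ, hd, rfl⟩
  exact h n q ψ hq hψ hd (hρ.sum_weights_eq_one hψ hd)

end ConvexRoof

/-! ### Branches of a protocol and the ensembles they generate. -/

section Protocol

variable {a' b' m : ℕ}

theorem SLOCC.map_sum_smul {a b : ℕ} (Λ : SLOCC a' b' m a b) (M : Fin m) {ι : Type*}
    (s : Finset ι) (c : ι → ℂ) (ρ : ι → Op a b) :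
    Λ.map M (∑ μ ∈ s, c μ • ρ μ) = ∑ μ ∈ s, c μ • Λ.map M (ρ μ) := by
  induction Λ with
  | done M₀ => by_cases h : M = M₀ <;> simp [SLOCC.map, h]
  | alice n d K hK next ih =>
    simp only [SLOCC.map, Finset.smul_sum]
    rw [Finset.sum_comm]
    refine Finset.sum_congr rfl fun i _ => ?_
    rw [Matrix.mul_sum, Matrix.sum_mul, ← ih]
    simp only [Matrix.mul_smul, Matrix.smul_mul]
  | bob n d K hK next ih =>
    simp only [SLOCC.map, Finset.smul_sum]
    rw [Finset.sum_comm]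
    refine Finset.sum_congr rfl fun i _ => ?_
    rw [Matrix.mul_sum, Matrix.sum_mul, ← ih]
    simp only [Matrix.mul_smul, Matrix.smul_mul]

/-- The fine-grained branches of a protocol that is applied to a pure state. -/
theorem SLOCC.exists_branches {a b : ℕ} (Λ : SLOCC a' b' m a b) {α : ℝ} (h0 : 0 < α) (h1 : α ≤ 1)
    (ψ : Vec a b) :
    ∃ (ι : Type) (_ : Fintype ι) (l : ι → Fin m) (φ : ι → Vec a' b'),
      (∀ M, Λ.map M (ketbra ψ) = ∑ r, if l r = M then ketbra (φ r) else 0) ∧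
      ∑ r, normSq (φ r) = normSq ψ ∧ ∑ r, pureRoot α (φ r) ≤ pureRoot α ψ := by
  induction Λ with
  | done M₀ =>
    refine ⟨Unit, inferInstance, fun _ => M₀, fun _ => ψ, fun M => ?_, by simp, by simp⟩
    simp [SLOCC.map, eq_comm]
  | alice n d K hK next ih =>
    -- Branch vectors stay unnormalised, so branches of probability zero need no separate treatment
    -- in the induction.
    choose ι inst l φ hmap hnorm hroot using
      fun i => ih i ((K i ⊗ₖ (1 : Matrix _ _ ℂ)) *ᵥ ψ)
    refine ⟨Σ i, ι i, inferInstance, fun x => l x.1 x.2, fun x => φ x.1 x.2, fun M => ?_, ?_, ?_⟩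
    · simp only [SLOCC.map, mul_ketbra_mul_conjTranspose, hmap, Fintype.sum_sigma]
    · simp only [Fintype.sum_sigma, hnorm, sum_normSq_alice hK]
    · rw [Fintype.sum_sigma]
      exact (Finset.sum_le_sum fun i _ => hroot i).trans (sum_pureRoot_alice_le hK ψ h0 h1)
  | bob n d K hK next ih =>
    choose ι inst l φ hmap hnorm hroot using
      fun i => ih i (((1 : Matrix _ _ ℂ) ⊗ₖ K i) *ᵥ ψ)
    refine ⟨Σ i, ι i, inferInstance, fun x => l x.1 x.2, fun x => φ x.1 x.2, fun M => ?_, ?_, ?_⟩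
    · simp only [SLOCC.map, mul_ketbra_mul_conjTranspose, hmap, Fintype.sum_sigma]
    · simp only [Fintype.sum_sigma, hnorm, sum_normSq_bob hK]
    · rw [Fintype.sum_sigma]
      exact (Finset.sum_le_sum fun i _ => hroot i).trans (sum_pureRoot_bob_le hK ψ h0 h1)

/-- The branches of a protocol that is applied to a normalised pure state, with their
probabilities. -/
theorem SLOCC.exists_ensemble {a b : ℕ} (Λ : SLOCC a' b' m a b) {α : ℝ} (h0 : 0 < α) (h1 : α ≤ 1)
    {ψ : Vec a b} (hψ : IsUnitVec ψ) :
    ∃ (ι : Type) (_ : Fintype ι) (l : ι → Fin m) (p : ι → ℝ) (χ : ι → Vec a' b'),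
      (∀ r, 0 ≤ p r) ∧ (∀ r, IsUnitVec (χ r)) ∧ ∑ r, p r = 1 ∧
      (∀ M, Λ.map M (ketbra ψ) =
        ∑ r, ((if l r = M then p r else 0 : ℝ) : ℂ) • ketbra (χ r)) ∧
      ∑ r, p r * pureRoot α (χ r) ≤ pureRoot α ψ := by
  obtain ⟨ι, inst, l, φ, hmap, hnorm, hroot⟩ := Λ.exists_branches h0 h1 ψ
  rw [show normSq ψ = 1 from hψ] at hnorm
  obtain ⟨r₀, -, hr₀⟩ : ∃ r ∈ Finset.univ, normSq (φ r) ≠ 0 := by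
    apply Finset.exists_ne_zero_of_sum_ne_zero
    rw [hnorm]; exact one_ne_zero
  choose χ hχ hφ using fun r => exists_isUnitVec_smul hr₀ (φ r)
  have hnn : ∀ r, 0 ≤ normSq (φ r) := fun r => Finset.sum_nonneg fun _ _ => by positivity
  refine ⟨ι, inst, l, fun r => normSq (φ r), χ, hnn, hχ, hnorm, fun M => ?_, ?_⟩
  · rw [hmap]
    refine Finset.sum_congr rfl fun r _ => ?_
    split_ifs
    · conv_lhs => rw [hφ r]
      rw [ketbra_real_smul, Real.sq_sqrt (hnn r)]
    · simp
  · refine (Finset.sum_le_sum fun r _ => ?_).trans hroot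
    have h := sq_mul_pureRoot_le (√(normSq (φ r))) (χ r) h0 h1
    rwa [Real.sq_sqrt (hnn r), ← hφ r] at h

/-- A protocol turns a pure-state ensemble into a pure-state ensemble, refining the reported
outcomes, in which a convex monotone function of the Rényi entanglement does not increase on
average. -/
theorem SLOCC.exists_refinement {a b : ℕ} (Λ : SLOCC a' b' m a b) {α : ℝ} (h0 : 0 < α)
    (h1 : α < 1) {G : ℝ → ℝ}
    (hG : ∀ {ι : Type} [Fintype ι] (p x : ι → ℝ) (y : ℝ), (∀ r, 0 ≤ p r) → ∑ r, p r = 1 →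
      ∑ r, p r * Real.exp ((1 - α) / α * x r) ≤ Real.exp ((1 - α) / α * y) →
      ∑ r, p r * G (x r) ≤ G y)
    {n : ℕ} {q : Fin n → ℝ} {ψ : Fin n → Vec a b} (hq : ∀ μ, 0 ≤ q μ)
    (hψ : ∀ μ, IsUnitVec (ψ μ)) (hq1 : ∑ μ, q μ = 1) :
    ∃ (ι : Type) (_ : Fintype ι) (l : ι → Fin m) (w : ι → ℝ) (χ : ι → Vec a' b'),
      (∀ r, 0 ≤ w r) ∧ (∀ r, IsUnitVec (χ r)) ∧ ∑ r, w r = 1 ∧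
      (∀ M, Λ.map M (∑ μ, (q μ : ℂ) • ketbra (ψ μ)) =
        ∑ r, ((if l r = M then w r else 0 : ℝ) : ℂ) • ketbra (χ r)) ∧
      ∑ r, w r * G (REE α (χ r)) ≤ ∑ μ, q μ * G (REE α (ψ μ)) := by
  choose ι inst l p χ hp hχ hp1 hmap hroot using fun μ => Λ.exists_ensemble h0 h1.le (hψ μ)
  refine ⟨Σ μ, ι μ, inferInstance, fun x => l x.1 x.2, fun x => q x.1 * p x.1 x.2,
    fun x => χ x.1 x.2, fun x => mul_nonneg (hq _) (hp _ _), fun x => hχ _ _, ?_, fun M => ?_, ?_⟩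
  · simp only [Fintype.sum_sigma, ← Finset.mul_sum, hp1, mul_one, hq1]
  · rw [SLOCC.map_sum_smul, Fintype.sum_sigma]
    refine Finset.sum_congr rfl fun μ _ => ?_
    rw [hmap, Finset.smul_sum]
    refine Finset.sum_congr rfl fun r _ => ?_
    rw [smul_smul]
    split_ifs <;> simp
  · rw [Fintype.sum_sigma]
    refine Finset.sum_le_sum fun μ _ => ?_
    simp only [mul_assoc, ← Finset.mul_sum]
    refine mul_le_mul_of_nonneg_left (hG _ _ _ (hp μ) (hp1 μ) ?_) (hq μ)
    have h := hroot μ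
    rw [pureRoot_eq_exp (hψ μ) h1] at h
    simpa only [pureRoot_eq_exp (hχ μ _) h1] using h

theorem SLOCC.prob_eq_sum {a b : ℕ} (Λ : SLOCC a' b' m a b) {ρ : Op a b}
    {ι : Type} [Fintype ι] {l : ι → Fin m} {w : ι → ℝ} {χ : ι → Vec a' b'}
    (hχ : ∀ r, IsUnitVec (χ r))
    (hmap : ∀ M, Λ.map M ρ = ∑ r, ((if l r = M then w r else 0 : ℝ) : ℂ) • ketbra (χ r))
    (M : Fin m) : Λ.prob ρ M = ∑ r, if l r = M then w r else 0 := by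
  rw [SLOCC.prob, hmap, sum_weights_eq_trace hχ, Complex.ofReal_re]

/-- The average of a convex monotone function of the convex roof over the outcomes is at most the
average over any refinement of the outcomes into pure states. -/
theorem SLOCC.average_le {a b : ℕ} (Λ : SLOCC a' b' m a b) {ρ : Op a b} {α γ : ℝ} (h0 : 0 < α)
    (h1 : α < 1) (hγ : α ≤ γ) {G : ℝ → ℝ} (hmono : Monotone G) (hconv : ConvexOn ℝ Set.univ G)
    {ι : Type} [Fintype ι] {l : ι → Fin m} {w : ι → ℝ} {χ : ι → Vec a' b'}
    (hw : ∀ r, 0 ≤ w r) (hχ : ∀ r, IsUnitVec (χ r))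
    (hmap : ∀ M, Λ.map M ρ = ∑ r, ((if l r = M then w r else 0 : ℝ) : ℂ) • ketbra (χ r)) :
    Λ.average ρ (fun σ => G (coREE γ σ)) ≤ ∑ r, w r * G (REE α (χ r)) := by
  have hprob := Λ.prob_eq_sum hχ hmap
  have hsplit : ∑ r, w r * G (REE α (χ r)) =
      ∑ M, ∑ r, (if l r = M then w r else 0) * G (REE α (χ r)) := by
    rw [Finset.sum_comm]
    refine Finset.sum_congr rfl fun r _ => ?_
    simp
  rw [hsplit, SLOCC.average]
  refine Finset.sum_le_sum fun M _ => ?_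
  have hv : ∀ r, 0 ≤ (if l r = M then w r else 0) := fun r => by
    split_ifs
    exacts [hw r, le_rfl]
  specialize hprob M
  specialize hmap M
  generalize hvdef : (fun r => if l r = M then w r else 0) = v
  have hvr : ∀ r, (if l r = M then w r else 0) = v r := fun r => congrFun hvdef r
  simp only [hvr] at hprob hmap hv ⊢
  have hP : 0 ≤ Λ.prob ρ M := hprob ▸ Finset.sum_nonneg fun r _ => hv r
  rcases hP.eq_or_lt with hP | hP
  -- Here the post-measurement state is meaningless, but all branch weights vanish and both sides
  -- are zero.
  · rw [← hP, zero_mul]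
    rw [← hP] at hprob
    have := (Finset.sum_eq_zero_iff_of_nonneg fun r _ => hv r).1 hprob.symm
    exact (Finset.sum_eq_zero fun r hr => by rw [this r hr, zero_mul]).ge
  · have hu : ∀ r, 0 ≤ v r / Λ.prob ρ M := fun r => div_nonneg (hv r) hP.le
    have hu1 : ∑ r, v r / Λ.prob ρ M = 1 := by
      rw [← Finset.sum_div, ← hprob, div_self hP.ne']
    have hpost : Λ.post ρ M = ∑ r, ((v r / Λ.prob ρ M : ℝ) : ℂ) • ketbra (χ r) := by
      rw [SLOCC.post, hmap, Finset.smul_sum]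
      refine Finset.sum_congr rfl fun r _ => ?_
      rw [smul_smul, Complex.ofReal_div, div_eq_inv_mul]
    have hco : coREE γ (Λ.post ρ M) ≤ ∑ r, v r / Λ.prob ρ M * REE α (χ r) := by
      rw [hpost]
      refine (convexRoof_le (fun ψ hψ => REE_nonneg hψ (h0.trans_le hγ)) hu hχ).trans ?_
      exact Finset.sum_le_sum fun r _ =>
        mul_le_mul_of_nonneg_left (REE_anti (hχ r) h0 h1 hγ) (hu r)
    have hJ := hconv.map_sum_le (t := Finset.univ) (fun r _ => hu r) hu1
      (p := fun r => REE α (χ r)) (fun _ _ => Set.mem_univ _)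
    simp only [smul_eq_mul] at hJ
    have h := mul_le_mul_of_nonneg_left ((hmono hco).trans hJ) hP.le
    refine h.trans (le_of_eq ?_)
    rw [Finset.mul_sum]
    refine Finset.sum_congr rfl fun r _ => ?_
    field_simp

/-! ### Averaged inequalities for mixed states and the probability bound. -/

/-- The common core of the inequalities for `s > 0` and `s = 0`. -/
theorem SLOCC.average_coREE_le {a b : ℕ} (Λ : SLOCC a' b' m a b) {α γ : ℝ} (h0 : 0 < α)
    (h1 : α < 1) (hγ : α ≤ γ) {G : ℝ → ℝ} (hmono : Monotone G) (hconv : ConvexOn ℝ Set.univ G)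
    (hG : ∀ {ι : Type} [Fintype ι] (p x : ι → ℝ) (y : ℝ), (∀ r, 0 ≤ p r) → ∑ r, p r = 1 →
      ∑ r, p r * Real.exp ((1 - α) / α * x r) ≤ Real.exp ((1 - α) / α * y) →
      ∑ r, p r * G (x r) ≤ G y)
    {n : ℕ} {q : Fin n → ℝ} {ψ : Fin n → Vec a b} (hq : ∀ μ, 0 ≤ q μ)
    (hψ : ∀ μ, IsUnitVec (ψ μ)) (hq1 : ∑ μ, q μ = 1) :
    Λ.average (∑ μ, (q μ : ℂ) • ketbra (ψ μ)) (fun σ => G (coREE γ σ)) ≤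
      ∑ μ, q μ * G (REE α (ψ μ)) := by
  obtain ⟨ι, inst, l, w, χ, hw, hχ, -, hmap, hle⟩ := Λ.exists_refinement h0 h1 hG hq hψ hq1
  exact (Λ.average_le h0 h1 hγ hmono hconv hw hχ hmap).trans hle

theorem SLOCC.average_exp_coREE_le {a b : ℕ} {ρ : Op a b} (hρ : IsState ρ)
    (Λ : SLOCC a' b' m a b) {α γ s : ℝ} (h0 : 0 < α) (h1 : α < 1) (hγ : α ≤ γ) (hs : 0 < s)
    (hsα : s ≤ 1 / α) :
    1 / (s * (1 - α)) *
      (Λ.average ρ (fun σ => Real.exp (s * (1 - α) * coREE γ σ)) - 1) ≤ coGEE α s ρ := by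
  have h1' : 0 < 1 - α := by linarith
  have hc : 0 < s * (1 - α) := mul_pos hs h1'
  refine le_convexRoof hρ fun n q ψ hq hψ hd hq1 => ?_
  have h := Λ.average_coREE_le (G := fun x => Real.exp (s * (1 - α) * x)) h0 h1 hγ
    (fun x y hxy => Real.exp_le_exp.2 (mul_le_mul_of_nonneg_left hxy hc.le))
    (by simpa [Function.comp_def, mul_assoc] using
      convexOn_exp.comp_linearMap (LinearMap.mulLeft ℝ (s * (1 - α))))
    (fun p x y hp hp1 hle => by
      -- The power sα turns the exponent (1-α)/α into s(1-α); s ≤ 1/α makes it concave.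
      have hJ := sum_mul_rpow_le_rpow_sum hp hp1
        (z := fun r => Real.exp ((1 - α) / α * x r)) (fun r => (Real.exp_pos _).le)
        (mul_pos hs h0) ((le_div_iff₀ h0).1 hsα)
      have hJ' := hJ.trans (Real.rpow_le_rpow (Finset.sum_nonneg fun r _ =>
        mul_nonneg (hp r) (Real.exp_pos _).le) hle (mul_pos hs h0).le)
      have he : ∀ t, Real.exp ((1 - α) / α * t) ^ (s * α) = Real.exp (s * (1 - α) * t) :=
        fun t => by
          rw [← Real.exp_mul]; congr 1; field_simp
      simpa only [he] using hJ')
    hq hψ hq1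
  rw [← hd] at h
  have hsum : ∑ μ, q μ * GEE α s (ψ μ) =
      1 / (s * (1 - α)) * (∑ μ, q μ * Real.exp (s * (1 - α) * REE α (ψ μ)) - 1) := by
    rw [← congrArg (_ - ·) hq1, ← Finset.sum_sub_distrib, Finset.mul_sum]
    refine Finset.sum_congr rfl fun μ _ => ?_
    rw [GEE]; ring
  rw [hsum]
  exact mul_le_mul_of_nonneg_left (by linarith) (by positivity)

theorem SLOCC.average_coREE_le_coREE {a b : ℕ} {ρ : Op a b} (hρ : IsState ρ)
    (Λ : SLOCC a' b' m a b) {α γ : ℝ} (h0 : 0 < α) (h1 : α < 1) (hγ : α ≤ γ) :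
    Λ.average ρ (fun σ => coREE γ σ) ≤ coREE α ρ := by
  have h1' : 0 < 1 - α := by linarith
  have hc : 0 < (1 - α) / α := by positivity
  refine le_convexRoof hρ fun n q ψ hq hψ hd hq1 => ?_
  have h := Λ.average_coREE_le (G := fun x => x) h0 h1 hγ monotone_id
    (convexOn_id convex_univ)
    (fun p x y hp hp1 hle => by
      have hJ := sum_mul_log_le_log_sum hp hp1
        (z := fun r => Real.exp ((1 - α) / α * x r)) (fun r _ => Real.exp_pos _)
      have hpos : 0 < ∑ r, p r * Real.exp ((1 - α) / α * x r) := by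
        obtain ⟨i, -, hi⟩ := Finset.exists_ne_zero_of_sum_ne_zero (hp1.trans_ne one_ne_zero)
        exact Finset.sum_pos' (fun r _ => mul_nonneg (hp r) (Real.exp_pos _).le)
          ⟨i, Finset.mem_univ _, mul_pos (lt_of_le_of_ne (hp i) hi.symm) (Real.exp_pos _)⟩
      have hJ' := hJ.trans (Real.log_le_log hpos hle)
      simp only [Real.log_exp, mul_left_comm (p _)] at hJ'
      rw [← Finset.mul_sum] at hJ'
      exact le_of_mul_le_mul_left hJ' hc)
    hq hψ hq1
  rwa [← hd] at h

theorem SLOCC.prob_nonneg_and_sum_eq_one {a b : ℕ} {ρ : Op a b} (hρ : IsState ρ)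
    (Λ : SLOCC a' b' m a b) : (∀ M, 0 ≤ Λ.prob ρ M) ∧ ∑ M, Λ.prob ρ M = 1 := by
  obtain ⟨n, q, ψ, hq, hψ, hd⟩ := hρ.exists_decomposition
  -- Only the weights matter, so any order in (0, 1) and the trivial G will do.
  obtain ⟨ι, inst, l, w, χ, hw, hχ, hw1, hmap, -⟩ := Λ.exists_refinement (α := 1 / 2)
    (by norm_num) (by norm_num) (G := fun _ => 0) (by simp) hq hψ (hρ.sum_weights_eq_one hψ hd)
  rw [← hd] at hmap
  have hprob := Λ.prob_eq_sum hχ hmap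
  refine ⟨fun M => ?_, ?_⟩
  · rw [hprob]
    refine Finset.sum_nonneg fun r _ => ?_
    split_ifs
    exacts [hw r, le_rfl]
  · simp only [hprob]
    rw [Finset.sum_comm]
    simpa using hw1

/-- Markov's inequality for the entanglement after the protocol. -/
theorem SLOCC.successProb_le_distillBound {a b : ℕ} {ρ : Op a b} (hρ : IsState ρ)
    (Λ : SLOCC a' b' m a b) {α β t : ℝ} (ht : 0 < t) (h0 : 0 < β) (hβ : β ≤ α) (h1 : β < 1) :
    Λ.successProb ρ (fun σ => coREE α σ) t ≤ distillBound ρ t β := by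
  obtain ⟨hp, hp1⟩ := Λ.prob_nonneg_and_sum_eq_one hρ
  have h1' : 0 < 1 - β := by linarith
  set c := (1 - β) / β with hc
  have hc0 : 0 < c := by positivity
  have h := Λ.average_exp_coREE_le hρ h0 h1 hβ (s := 1 / β) (by positivity) le_rfl
  have hcs : 1 / β * (1 - β) = c := by rw [hc]; ring
  rw [hcs] at h
  have h2 : Λ.average ρ (fun σ => Real.exp (c * coREE α σ)) - 1 ≤ c * coGEE β (1 / β) ρ := by
    rw [one_div, ← div_eq_inv_mul, div_le_iff₀ hc0] at h
    linarith
  rw [distillBound, ← hc, le_div_iff₀ (by have := Real.one_lt_exp_iff.2 (mul_pos hc0 ht); linarith)]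
  refine le_trans ?_ h2
  rw [SLOCC.average, SLOCC.successProb, Finset.sum_mul]
  refine le_of_le_of_eq ?_ (congrArg (_ - ·) hp1)
  rw [← Finset.sum_sub_distrib]
  refine Finset.sum_le_sum fun M _ => ?_
  -- This makes e^(cE) - 1 nonnegative on the unsuccessful outcomes, which can then be dropped.
  have hco : 0 ≤ coREE α (Λ.post ρ M) :=
    convexRoof_nonneg (fun ψ hψ => REE_nonneg hψ (h0.trans_le hβ)) _
  split_ifs with hM
  · have := mul_le_mul_of_nonneg_left
      (Real.exp_le_exp.2 (mul_le_mul_of_nonneg_left hM hc0.le)) (hp M)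
    linarith
  · have := mul_le_mul_of_nonneg_left (Real.one_le_exp (mul_nonneg hc0.le hco)) (hp M)
    linarith

end Protocol

end Ent

theorem proposition4 {a b a' b' m : ℕ} (ρ : Ent.Op a b) (hρ : Ent.IsState ρ)
    (Λ : Ent.SLOCC a' b' m a b) :
    -- the inequality for `0 < s ≤ 1 / α`, and its limiting case `s = 0`
    (∀ α γ : ℝ, 0 < α → α < 1 → α ≤ γ →
      (∀ s : ℝ, 0 < s → s ≤ 1 / α →
        Ent.coGEE α s ρ ≥
          1 / (s * (1 - α)) *
            (Λ.average ρ (fun σ => Real.exp (s * (1 - α) * Ent.coREE γ σ)) - 1)) ∧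
      Ent.coREE α ρ ≥ Λ.average ρ (fun σ => Ent.coREE γ σ)) ∧
    -- the probability bound, for every `0 < β ≤ α`, and for `β = 0` as the limit `β → 0`
    (∀ α t : ℝ, 0 < α → 0 < t →
      (∀ β : ℝ, 0 < β → β ≤ α → β < 1 →
        Λ.successProb ρ (fun σ => Ent.coREE α σ) t ≤ Ent.distillBound ρ t β) ∧
      ((Λ.successProb ρ (fun σ => Ent.coREE α σ) t : ℝ) : EReal) ≤
        Filter.liminf (fun β : ℝ => ((Ent.distillBound ρ t β : ℝ) : EReal))
          (nhdsWithin 0 (Set.Ioi 0))) := by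
  refine ⟨fun α γ h0 h1 hγ => ⟨fun s hs hsα => Λ.average_exp_coREE_le hρ h0 h1 hγ hs hsα,
    Λ.average_coREE_le_coREE hρ h0 h1 hγ⟩, fun α t h0 ht =>
    ⟨fun β hβ hβα hβ1 => Λ.successProb_le_distillBound hρ ht hβ hβα hβ1, ?_⟩⟩
  -- The bound holds for every β in (0, min α 1), hence eventually as β → 0⁺.
  refine Filter.le_liminf_of_le (by isBoundedDefault) ?_
  filter_upwards [Ioo_mem_nhdsGT (lt_min h0 one_pos)] with β hβ
  exact EReal.coe_le_coe_iff.2 (Λ.successProb_le_distillBound hρ ht hβ.1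
    (hβ.2.le.trans (min_le_left _ _)) (hβ.2.trans_le (min_le_right _ _)))
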